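/- All graphs are finite, simple and undirected. For an integer $p\ge 1$, an $L(p,1)$-labelling of a graph $G$ is a function $c:V(G)\to\mathbb{Z}$ such that $c(v)\neq c(w)$ and $|c(v)-c(w)|\ge p$ for every edge $vw$, and such that every subgraph of $G$ isomorphic to the path $P_3$ on three vertices receives three distinct colours. Let $\Lambda_{p,1}(G)$ be the minimum of $\max_{vw\in E(G)}|c(v)-c(w)|$, and let $\lambda_{p,1}(G)$ be the minimum of $\max_{v}c(v)-\min_{v}c(v)$, both taken over all $L(p,1)$-labellings $c$ of $G$ (a maximum over the empty set of edges is $0$, and the difference is $0$ if there are no vertices). The Cartesian product $G_1\square\cdots\square G_d$ has vertex set $V(G_1)\times\cdots\times V(G_d)$, two tuples being adjacent if they are adjacent in exactly one coordinate and equal in all other coordinates. **Theorem.** Let $p\ge1$, $k\ge 0$ and $d\ge 1$ be integers, and let $G_1,\dots,G_d$ be graphs, each with $\Lambda_{p,1}(G_i)\le k$ (which is implied if $\lambda_{p,1}(G_i)\le k$). Then $$\Lambda_{p,1}(G_1\square\cdots\square G_d)\le k(kd-k+1)\quad\text{and}\quad \lambda_{p,1}(G_1\square\cdots\square G_d)\le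 2k(kd-k+1)+1.$$ Moreover, for every integer $k\ge 2$ and every real $\epsilon$ with $0<\epsilon<1$ there is an integer $d(k,\epsilon)$ (depending only on $k$ and $\epsilon$) such that for every $d>d(k,\epsilon)$, every $p\ge1$ and all graphs $G_1,\dots,G_d$ with $\Lambda_{p,1}(G_i)\le k$ for all $i$, $$\Lambda_{p,1}(G_1\square\cdots\square G_d)\le \frac{e^{\gamma}}{1-\epsilon}\,dk\log k\quad\text{and}\quad \lambda_{p,1}(G_1\square\cdots\square G_d)\le 1+\frac{2e^{\gamma}}{1-\epsilon}\,dk\log k,$$ where $\gamma$ is Euler's constant and $\log$ is the natural logarithm. -/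

import Mathlib

universe u v

/-- The Cartesian product of a family of graphs: two tuples are adjacent when they are adjacent
in one coordinate and equal in all the others. -/
def cartesianProduct {ι : Type v} {V : ι → Type u} (G : ∀ i, SimpleGraph (V i)) :
    SimpleGraph (∀ i, V i) where
  Adj x y := ∃ i, (G i).Adj (x i) (y i) ∧ ∀ j, j ≠ i → x j = y j
  symm := ⟨by
    rintro x y ⟨i, h, h'⟩
    exact ⟨i, h.symm, fun j hj => (h' j hj).symm⟩⟩
  loopless := ⟨by
    rintro x ⟨i, h, -⟩
    exact (G i).loopless.irrefl _ h⟩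

/-- An integer (proper) colouring is `P₃`-free if every subgraph isomorphic to the path on three
vertices receives at least three colours. -/
def IsP3Free {V : Type u} {G : SimpleGraph V} (c : G.Coloring ℤ) : Prop :=
  ∀ H : G.Subgraph, Nonempty (H.coe ≃g SimpleGraph.pathGraph 3) → 3 ≤ (c '' H.verts).ncard

/-- `L(p,1)`-labellings: `P₃`-free colourings in which the colours of adjacent vertices differ
by at least `p`. -/
def IsLp1Labelling (p : ℕ) {V : Type u} {G : SimpleGraph V} (c : G.Coloring ℤ) : Prop :=
  IsP3Free c ∧ ∀ x y, G.Adj x y → (p : ℤ) ≤ |c x - c y|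

/-- Every finite graph has an `L(p,1)`-labelling, so the minima below are over nonempty sets. -/
theorem exists_isLp1Labelling (p : ℕ) {V : Type u} [Finite V] (G : SimpleGraph V) :
    ∃ c : G.Coloring ℤ, IsLp1Labelling p c := by
  obtain ⟨n, ⟨e⟩⟩ := Finite.exists_equiv_fin V
  have key : ∀ x y : V, x ≠ y →
      ((p : ℤ) + 1) ≤ |((p : ℤ) + 1) * ((e x : ℕ) : ℤ) - ((p : ℤ) + 1) * ((e y : ℕ) : ℤ)| := by
    intro x y h
    have h1 : ((e x : ℕ) : ℤ) - ((e y : ℕ) : ℤ) ≠ 0 := by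
      intro h0
      exact h (e.injective (Fin.ext (by omega)))
    rw [← mul_sub, abs_mul, abs_of_nonneg (by positivity : (0 : ℤ) ≤ (p : ℤ) + 1)]
    have h2 := Int.one_le_abs h1
    nlinarith
  have inj : Function.Injective fun x : V => ((p : ℤ) + 1) * ((e x : ℕ) : ℤ) := by
    intro x y h
    by_contra hne
    have h1 := key x y hne
    simp only at h
    rw [h, sub_self, abs_zero] at h1
    omega
  refine ⟨SimpleGraph.Coloring.mk (fun x => ((p : ℤ) + 1) * ((e x : ℕ) : ℤ)) ?_, ?_, ?_⟩
  · intro x y h heq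
    exact h.ne (inj heq)
  · rintro H ⟨f⟩
    have h3 : H.verts.ncard = 3 := by
      rw [← Nat.card_coe_set_eq, Nat.card_congr f.toEquiv, Nat.card_fin]
    exact (h3.symm.trans (Set.ncard_image_of_injective H.verts inj).symm).le
  · intro x y h
    exact le_trans (by omega) (key x y h.ne)

/-- The maximum of `|c x - c y|` over the edges `xy` (`0` if there are no edges). -/
noncomputable def edgeSpan {V : Type u} {G : SimpleGraph V} (c : G.Coloring ℤ) : ℕ :=
  sSup {n : ℕ | ∃ x y, G.Adj x y ∧ (c x - c y).natAbs = n}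

/-- The largest colour minus the smallest colour (`0` if there are no vertices). -/
noncomputable def totalSpan {V : Type u} {G : SimpleGraph V} (c : G.Coloring ℤ) : ℕ :=
  ((⨆ x, c x) - ⨅ x, c x).toNat

/-- `Λ_{p,1}(G)`: the minimum of the edge span over all `L(p,1)`-labellings. -/
noncomputable def bigLambda (p : ℕ) {V : Type u} (G : SimpleGraph V) : ℕ :=
  sInf {n : ℕ | ∃ c : G.Coloring ℤ, IsLp1Labelling p c ∧ edgeSpan c = n}

/-- `λ_{p,1}(G)`: the minimum of the total span over all `L(p,1)`-labellings. -/
noncomputable def smallLambda (p : ℕ) {V : Type u} (G : SimpleGraph V) : ℕ :=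
  sInf {n : ℕ | ∃ c : G.Coloring ℤ, IsLp1Labelling p c ∧ totalSpan c = n}

/-! Optimal labellings `c i` of the factors map the product into `ℤ^d`, each edge becoming a step
`s` in one coordinate with `p ≤ |s| ≤ k`. So it suffices to label `ℤ^d` by some `F` that takes
distinct values at the ends of distinct allowed steps from any point and changes by at least `p` and
by little along each step (`bigLambda_cartesianProduct_le`). The linear form with weights `k * i +
1` gives the bound for all `d`.

For large `d`, a homomorphism from `ℤ^d` to `ℤ × H`, with `H` finite, is followed by an enumeration
of `ℤ × H`. If the nonzero multiples, by integers up to `k` in absolute value, of the images of the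
unit vectors are distinct, the edge span is at most `(k + 1) * |H|`. With `H` cyclic of order about
`d`, this is about `(k + 1) * d`, which is enough for `k ≥ 3`. For `k = 2`, a Hamming-type code
packs more generators into `H` when `p = 1`, and weights `1, …, d` suffice when `p ≥ 2`. The
constant `e^γ` enters only through a numerical lower bound, and neither the factor `1 / (1 - ε)` nor
the extra `1` is needed.

Finally `λ ≤ 2Λ`, by reducing colours modulo `2Λ + 1`. -/

theorem isP3Free_iff {V : Type u} {G : SimpleGraph V} (c : G.Coloring ℤ) :
    IsP3Free c ↔ ∀ x y z, G.Adj x y → G.Adj y z → x ≠ z → c x ≠ c z := by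
  constructor
  · intro h x y z hxy hyz hxz heq
    let f : SimpleGraph.pathGraph 3 →g G :=
      { toFun := ![x, y, z]
        map_rel' := by
          intro a b hab
          rw [SimpleGraph.pathGraph_adj] at hab
          fin_cases a <;> fin_cases b <;> simp_all [SimpleGraph.adj_comm] }
    have hf : Function.Injective f := by
      intro a b hab
      have h1 := hxy.ne
      have h2 := hyz.ne
      fin_cases a <;> fin_cases b <;> simp_all [f, eq_comm]
    let C : SimpleGraph.Copy (SimpleGraph.pathGraph 3) G := ⟨f, hf⟩
    have h3 := h C.toSubgraph ⟨C.isoToSubgraph.symm⟩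
    have hsub : c '' C.toSubgraph.verts ⊆ {c x, c y} := by
      rintro _ ⟨v, hv, rfl⟩
      simp only [SimpleGraph.Copy.toSubgraph, SimpleGraph.Subgraph.map_verts,
        SimpleGraph.Subgraph.verts_top, Set.image_univ, Set.mem_range] at hv
      obtain ⟨i, rfl⟩ := hv
      fin_cases i <;> simp [C, f, heq]
    have h4 := (h3.trans (Set.ncard_le_ncard hsub (by simp))).trans (Set.ncard_insert_le _ _)
    simp at h4
  · rintro h H ⟨e⟩
    have hadj : ∀ a b : Fin 3, (SimpleGraph.pathGraph 3).Adj a b →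
        G.Adj (e.symm a) (e.symm b) := fun a b hab => (e.symm.map_rel_iff.2 hab).adj_sub
    have h01 := hadj 0 1 (by simp [SimpleGraph.pathGraph_adj])
    have h12 := hadj 1 2 (by simp [SimpleGraph.pathGraph_adj])
    have h02 : (e.symm 0 : V) ≠ e.symm 2 := by
      intro h0
      exact absurd (e.symm.injective (Subtype.ext h0)) (by decide)
    have hc := h _ _ _ h01 h12 h02
    have hsub : {c (e.symm 0), c (e.symm 1), c (e.symm 2)} ⊆ c '' H.verts := by
      rintro _ (rfl | rfl | rfl) <;> exact ⟨_, Subtype.property _, rfl⟩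
    have hfin : (c '' H.verts).Finite := by
      have : Finite H.verts := Finite.of_equiv _ e.toEquiv.symm
      exact (Set.toFinite H.verts).image c
    refine le_trans (le_of_eq ?_) (Set.ncard_le_ncard hsub hfin)
    rw [Set.ncard_eq_three.2 ⟨_, _, _, c.valid h01, hc, c.valid h12, rfl⟩]

theorem abs_sub_le_edgeSpan {V : Type u} [Finite V] {G : SimpleGraph V} (c : G.Coloring ℤ)
    {x y : V} (h : G.Adj x y) : |c x - c y| ≤ edgeSpan c := by
  rw [Int.abs_eq_natAbs]
  norm_cast
  refine le_csSup (Set.Finite.bddAbove ?_) ⟨x, y, h, rfl⟩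
  refine (Set.finite_range fun q : V × V => (c q.1 - c q.2).natAbs).subset ?_
  rintro _ ⟨x, y, -, rfl⟩
  exact ⟨(x, y), rfl⟩

theorem edgeSpan_le {V : Type u} {G : SimpleGraph V} (c : G.Coloring ℤ) (M : ℕ)
    (h : ∀ x y, G.Adj x y → |c x - c y| ≤ M) : edgeSpan c ≤ M := by
  refine csSup_le' ?_
  rintro _ ⟨x, y, hxy, rfl⟩
  have := h x y hxy
  rw [Int.abs_eq_natAbs] at this
  exact_mod_cast this

theorem totalSpan_le {V : Type u} {G : SimpleGraph V} (c : G.Coloring ℤ) (M : ℕ)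
    (h0 : ∀ x, 0 ≤ c x) (h : ∀ x, c x ≤ M) : totalSpan c ≤ M := by
  have h1 : (⨆ x, c x) ≤ M := by
    rcases isEmpty_or_nonempty V with hV | hV
    · rw [iSup_of_empty']
      simp
    · exact ciSup_le h
  have h2 : 0 ≤ ⨅ x, c x := by
    rcases isEmpty_or_nonempty V with hV | hV
    · rw [iInf_of_isEmpty]
      simp
    · exact le_ciInf h0
  unfold totalSpan
  omega

theorem edgeSpan_le_totalSpan {V : Type u} [Finite V] {G : SimpleGraph V} (c : G.Coloring ℤ) :
    edgeSpan c ≤ totalSpan c := by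
  refine edgeSpan_le c _ fun x y _ => ?_
  have ha := (Set.finite_range c).bddAbove
  have hb := (Set.finite_range c).bddBelow
  have h1 := le_ciSup ha x
  have h2 := le_ciSup ha y
  have h3 := ciInf_le hb x
  have h4 := ciInf_le hb y
  have h5 := Int.self_le_toNat ((⨆ x, c x) - ⨅ x, c x)
  unfold totalSpan
  rw [abs_le]
  constructor <;> linarith

theorem exists_edgeSpan_eq_bigLambda (p : ℕ) {V : Type u} [Finite V] (G : SimpleGraph V) :
    ∃ c : G.Coloring ℤ, IsLp1Labelling p c ∧ edgeSpan c = bigLambda p G := by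
  obtain ⟨c, hc⟩ := exists_isLp1Labelling p G
  exact Nat.sInf_mem (s := {n : ℕ | ∃ c : G.Coloring ℤ, IsLp1Labelling p c ∧ edgeSpan c = n})
    ⟨_, c, hc, rfl⟩

theorem exists_totalSpan_eq_smallLambda (p : ℕ) {V : Type u} [Finite V] (G : SimpleGraph V) :
    ∃ c : G.Coloring ℤ, IsLp1Labelling p c ∧ totalSpan c = smallLambda p G := by
  obtain ⟨c, hc⟩ := exists_isLp1Labelling p G
  exact Nat.sInf_mem (s := {n : ℕ | ∃ c : G.Coloring ℤ, IsLp1Labelling p c ∧ totalSpan c = n})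
    ⟨_, c, hc, rfl⟩

theorem bigLambda_le_edgeSpan {p : ℕ} {V : Type u} {G : SimpleGraph V} {c : G.Coloring ℤ}
    (hc : IsLp1Labelling p c) : bigLambda p G ≤ edgeSpan c :=
  Nat.sInf_le ⟨c, hc, rfl⟩

theorem smallLambda_le_totalSpan {p : ℕ} {V : Type u} {G : SimpleGraph V} {c : G.Coloring ℤ}
    (hc : IsLp1Labelling p c) : smallLambda p G ≤ totalSpan c :=
  Nat.sInf_le ⟨c, hc, rfl⟩

theorem bigLambda_le_smallLambda (p : ℕ) {V : Type u} [Finite V] (G : SimpleGraph V) :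
    bigLambda p G ≤ smallLambda p G := by
  obtain ⟨c, hc, h⟩ := exists_totalSpan_eq_smallLambda p G
  exact (bigLambda_le_edgeSpan hc).trans (h ▸ edgeSpan_le_totalSpan c)

/-! ### Bounding `λ` by `Λ` -/

/-- Reducing `a` and `b` modulo `N` either preserves their
difference or makes it at least `N - |a - b|`. -/
theorem emod_sub_emod_cases (a b N : ℤ) (hN : 0 < N) :
    a % N - b % N = a - b ∨ N - |a - b| ≤ |a % N - b % N| := by
  have ha := Int.emod_add_mul_ediv a N
  have hb := Int.emod_add_mul_ediv b N
  have e : a % N - b % N = (a - b) - N * (a / N - b / N) := by linarith [mul_sub N (a / N) (b / N)]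
  rw [e]
  generalize a / N - b / N = q
  rcases eq_or_ne q 0 with rfl | hq
  · left
    ring
  · right
    have h1 : N ≤ |N * q| := by
      rw [abs_mul, abs_of_pos hN]
      nlinarith [Int.one_le_abs hq]
    have h2 := abs_sub_abs_le_abs_sub (N * q) (a - b)
    rw [abs_sub_comm (N * q)] at h2
    linarith

/-- Modulo `N = 2M + 1`, the ends of a path on three vertices stay distinct, as their colours differ
by at most `2M`. An edge difference is either preserved or becomes at least `N - M > M`, hence still
at least `p`. -/
theorem smallLambda_le_two_mul_bigLambda (p : ℕ) {V : Type u} [Finite V] (G : SimpleGraph V) :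
    smallLambda p G ≤ 2 * bigLambda p G := by
  obtain ⟨c, hc, hM⟩ := exists_edgeSpan_eq_bigLambda p G
  rw [← hM]
  set M := edgeSpan c
  set N : ℤ := 2 * M + 1 with hN
  have hspan : ∀ x y, G.Adj x y → |c x - c y| ≤ M := fun x y h =>
    abs_sub_le_edgeSpan c h
  have hfree := (isP3Free_iff c).1 hc.1
  have hne : ∀ x y, c x ≠ c y → |c x - c y| < N → c x % N ≠ c y % N := by
    intro x y h h' h0
    have h1 := emod_sub_emod_cases (c x) (c y) N (by omega)
    rw [h0, sub_self, abs_zero] at h1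
    omega
  let c' : G.Coloring ℤ := SimpleGraph.Coloring.mk (fun x => c x % N) fun {x y} h =>
    hne x y (c.valid h) (by have := hspan x y h; omega)
  have hc' : ∀ x, c' x = c x % N := fun x => rfl
  have hlab : IsLp1Labelling p c' := by
    refine ⟨(isP3Free_iff c').2 fun x y z hxy hyz hxz => ?_, fun x y h => ?_⟩
    · refine hne x z (hfree x y z hxy hyz hxz) ?_
      have h1 := hspan x y hxy
      have h2 := hspan y z hyz
      have h3 := abs_sub_le (c x) (c y) (c z)
      omega
    · have h1 := hspan x y h
      have h2 := hc.2 x y h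
      rw [hc', hc']
      rcases emod_sub_emod_cases (c x) (c y) N (by omega) with h3 | h3
      · rwa [h3]
      · omega
  refine (smallLambda_le_totalSpan hlab).trans (totalSpan_le c' _ (fun x => ?_) fun x => ?_)
  · exact Int.emod_nonneg _ (by omega)
  · have := Int.emod_lt_of_pos (c x) (show 0 < N by omega)
    rw [hc']
    push_cast
    omega

/-! ### Labellings induced from `ℤ^d` -/

/-- A labelling of the Cartesian power of `ℤ` in which steps of length between `p` and `k` in
one coordinate are allowed induces a labelling of every Cartesian product. -/
theorem bigLambda_cartesianProduct_le {p k d M : ℕ} (F : (Fin d → ℤ) → ℤ) (hp : 1 ≤ p)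
    (hlow : ∀ (x : Fin d → ℤ) i (s : ℤ), p ≤ |s| → |s| ≤ k →
      (p : ℤ) ≤ |F (x + Pi.single i s) - F x|)
    (hup : ∀ (x : Fin d → ℤ) i (s : ℤ), p ≤ |s| → |s| ≤ k →
      |F (x + Pi.single i s) - F x| ≤ M)
    (hinj : ∀ (x : Fin d → ℤ) i j (s t : ℤ), p ≤ |s| → |s| ≤ k → p ≤ |t| → |t| ≤ k →
      F (x + Pi.single i s) = F (x + Pi.single j t) → i = j ∧ s = t)
    (V : Fin d → Type u) [∀ i, Finite (V i)] (G : ∀ i, SimpleGraph (V i))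
    (hG : ∀ i, bigLambda p (G i) ≤ k) : bigLambda p (cartesianProduct G) ≤ M := by
  choose c hc hspan using fun i => exists_edgeSpan_eq_bigLambda p (G i)
  let C : (∀ i, V i) → Fin d → ℤ := fun x i => c i (x i)
  have step : ∀ x y, (cartesianProduct G).Adj x y → ∃ i, (G i).Adj (x i) (y i) ∧
      (∀ j, j ≠ i → x j = y j) ∧ (p : ℤ) ≤ |C x i - C y i| ∧ |C x i - C y i| ≤ k ∧
      C x = C y + Pi.single i (C x i - C y i) := by
    rintro x y ⟨i, h, h'⟩
    refine ⟨i, h, h', (hc i).2 _ _ h, ?_, ?_⟩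
    · have h1 := abs_sub_le_edgeSpan (c i) h
      have h2 := hG i
      rw [← hspan i] at h2
      exact h1.trans (by exact_mod_cast h2)
    · ext j
      rcases eq_or_ne j i with rfl | hj
      · simp
      · simp [C, hj, h' j hj]
  have low : ∀ x y, (cartesianProduct G).Adj x y → (p : ℤ) ≤ |F (C x) - F (C y)| := by
    intro x y h
    obtain ⟨i, -, -, h1, h2, h3⟩ := step x y h
    have h4 := hlow (C y) i _ h1 h2
    rwa [← h3] at h4
  let c' : (cartesianProduct G).Coloring ℤ := SimpleGraph.Coloring.mk (fun x => F (C x))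
    fun {x y} h h0 => by
      have := low x y h
      rw [h0, sub_self, abs_zero] at this
      omega
  have hlab : IsLp1Labelling p c' := by
    refine ⟨(isP3Free_iff c').2 fun x y z hxy hyz hxz h0 => hxz ?_, low⟩
    obtain ⟨i, ai, bi, h1, h2, h3⟩ := step x y hxy
    obtain ⟨j, aj, bj, h1', h2', h3'⟩ := step z y hyz.symm
    have h0' : F (C x) = F (C z) := h0
    obtain ⟨rfl, h4⟩ := hinj (C y) i j _ _ h1 h2 h1' h2' (by rw [← h3, ← h3', h0'])
    ext l
    rcases eq_or_ne l i with rfl | hl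
    · by_contra hne
      -- Both edges at `y` lie in one coordinate and make the same step, so `x l ≠ z l` would
      -- contradict `P₃`-freeness in that factor.
      exact (isP3Free_iff (c l)).1 (hc l).1 _ _ _ ai aj.symm hne (by simpa [C] using h4)
    · rw [bi l hl, bj l hl]
  refine (bigLambda_le_edgeSpan hlab).trans (edgeSpan_le c' M fun x y h => ?_)
  obtain ⟨i, -, -, h1, h2, h3⟩ := step x y h
  have h4 := hup (C y) i _ h1 h2
  rwa [← h3] at h4

theorem bigLambda_cartesianProduct_le_linear {p k d A : ℕ} (a : Fin d → ℤ) (hp : 1 ≤ p)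
    (ha : ∀ i, 1 ≤ a i) (hA : ∀ i, a i ≤ A)
    (hinj : ∀ i j (s t : ℤ), p ≤ |s| → |s| ≤ k → p ≤ |t| → |t| ≤ k →
      s * a i = t * a j → i = j)
    (V : Fin d → Type u) [∀ i, Finite (V i)] (G : ∀ i, SimpleGraph (V i))
    (hG : ∀ i, bigLambda p (G i) ≤ k) : bigLambda p (cartesianProduct G) ≤ k * A := by
  have key : ∀ (x : Fin d → ℤ) i (s : ℤ),
      ∑ j, (x + Pi.single i s : Fin d → ℤ) j * a j = ∑ j, x j * a j + s * a i := by
    intro x i s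
    simp [add_mul, Finset.sum_add_distrib, Pi.single_apply]
  refine bigLambda_cartesianProduct_le (fun x => ∑ j, x j * a j) hp ?_ ?_ ?_ V G hG
  · intro x i s h1 h2
    simp only [key, add_sub_cancel_left, abs_mul, abs_of_pos (show 0 < a i by linarith [ha i])]
    nlinarith [ha i]
  · intro x i s h1 h2
    simp only [key, add_sub_cancel_left, abs_mul, abs_of_pos (show 0 < a i by linarith [ha i])]
    push_cast
    exact mul_le_mul h2 (hA i) (by linarith [ha i]) (by positivity)
  · intro x i j s t h1 h2 h3 h4 h5
    simp only [key, add_right_inj] at h5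
    obtain rfl := hinj i j s t h1 h2 h3 h4 h5
    exact ⟨rfl, mul_right_cancel₀ (by linarith [ha i]) h5⟩

/-- The integers congruent to `1` modulo `k` have no two distinct members with equal products by
integers in `[1, k]`. -/
theorem bigLambda_cartesianProduct_le_sq {p k d : ℕ} (hp : 1 ≤ p) (hd : 1 ≤ d)
    (V : Fin d → Type u) [∀ i, Finite (V i)] (G : ∀ i, SimpleGraph (V i))
    (hG : ∀ i, bigLambda p (G i) ≤ k) :
    bigLambda p (cartesianProduct G) ≤ k * (k * (d - 1) + 1) := by
  refine bigLambda_cartesianProduct_le_linear (fun i => k * (i : ℕ) + 1) hp (fun i => ?_)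
    (fun i => ?_) ?_ V G hG
  · have : (0 : ℤ) ≤ k * (i : ℕ) := by positivity
    linarith
  · have h : (i : ℕ) ≤ d - 1 := by omega
    exact_mod_cast Nat.add_le_add_right (Nat.mul_le_mul_left k h) 1
  · intro i j s t h1 h2 h3 h4 h5
    have hk : (0 : ℤ) < k := by omega
    have hpos : ∀ l : Fin d, (0 : ℤ) < k * (l : ℕ) + 1 := fun l => by positivity
    have h6 := congrArg abs h5
    rw [abs_mul, abs_mul, abs_of_pos (hpos i), abs_of_pos (hpos j)] at h6
    have h7 : |s| = |t| := by
      -- The weights are `1` modulo `k`, so `|s| ≡ |t|`; both lie in `[1, k]`, hence agree.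
      have hdvd : (k : ℤ) ∣ |s| - |t| := ⟨|t| * (j : ℕ) - |s| * (i : ℕ), by linarith⟩
      have := Int.eq_zero_of_abs_lt_dvd hdvd (by rw [abs_lt]; omega)
      linarith
    rw [h7] at h6
    have h8 := mul_left_cancel₀ (by omega) h6
    have h9 : (k : ℤ) * (i : ℕ) = k * (j : ℕ) := by linarith
    have h10 := mul_left_cancel₀ hk.ne' h9
    exact Fin.ext (by exact_mod_cast h10)

/-! ### Step-injective families in abelian groups -/

/-- The nonzero multiples `s • g i`, `|s| ≤ k`, of the members of the family `g` are pairwise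
distinct. -/
def StepInjective (k : ℕ) {A ι : Type*} [AddCommGroup A] (g : ι → A) : Prop :=
  ∀ i j (s t : ℤ), s ≠ 0 → |s| ≤ k → t ≠ 0 → |t| ≤ k → s • g i = t • g j → i = j ∧ s = t

theorem StepInjective.smul_ne_zero {k : ℕ} {A ι : Type*} [AddCommGroup A] {g : ι → A}
    (h : StepInjective k g) (i : ι) {s : ℤ} (hs : s ≠ 0) (hk : |s| ≤ k) : s • g i ≠ 0 := by
  intro h0
  have := (h i i s (-s) hs hk (by simpa) (by rwa [abs_neg]) (by rw [neg_smul, h0, neg_zero])).2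
  omega

theorem StepInjective.comp {k : ℕ} {A ι κ : Type*} [AddCommGroup A] {g : ι → A}
    (h : StepInjective k g) {f : κ → ι} (hf : Function.Injective f) : StepInjective k (g ∘ f) :=
  fun i j s t hs hs' ht ht' he =>
    let h' := h (f i) (f j) s t hs hs' ht ht' he
    ⟨hf h'.1, h'.2⟩

/-- No nonzero element is annihilated by a nonzero integer of absolute value at most `k`. -/
def NoSmallTorsion (k : ℕ) (B : Type*) [AddCommGroup B] : Prop :=
  ∀ s : ℤ, s ≠ 0 → |s| ≤ k → ∀ b : B, s • b = 0 → b = 0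

theorem NoSmallTorsion.prod {k : ℕ} {A B : Type*} [AddCommGroup A] [AddCommGroup B]
    (hA : NoSmallTorsion k A) (hB : NoSmallTorsion k B) : NoSmallTorsion k (A × B) :=
  fun s hs hk _ h => Prod.ext (hA s hs hk _ (congrArg Prod.fst h))
    (hB s hs hk _ (congrArg Prod.snd h))

theorem noSmallTorsion_zmod {k m : ℕ} (h : m.Coprime k.factorial) : NoSmallTorsion k (ZMod m) := by
  intro s hs hk b hb
  have hcop : IsCoprime s (m : ℤ) := by
    rw [Int.isCoprime_iff_gcd_eq_one]
    refine Nat.Coprime.symm (h.coprime_dvd_right (Nat.dvd_factorial ?_ ?_))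
    · exact Int.natAbs_pos.2 hs
    · rw [Int.abs_eq_natAbs] at hk
      exact_mod_cast hk
  obtain ⟨u, v, huv⟩ := hcop
  calc b = (u * s + v * m) • b := by rw [huv, one_smul]
    _ = u • (s • b) + v • ((m : ℤ) • b) := by rw [add_smul, mul_smul, mul_smul]
    _ = 0 := by simp [hb]

/-- A Hamming-type construction: adjoin a new leading coordinate. -/
theorem StepInjective.sumElim {k : ℕ} {R B ι : Type*} [CommRing R] [AddCommGroup B]
    (hR : ∀ s t : ℤ, |s| ≤ k → |t| ≤ k → (s : R) = t → s = t) (hB : NoSmallTorsion k B)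
    {g : ι → B} (hg : StepInjective k g) :
    StepInjective k (Sum.elim (fun b => ((1 : R), b)) fun i => ((0 : R), g i)) := by
  have h0 : ∀ s : ℤ, |s| ≤ k → (s : R) = 0 → s = 0 := fun s hs h =>
    hR s 0 hs (by simp) (by simpa using h)
  rintro (b | i) (b' | j) s t hs hs' ht ht' h
  -- The leading coordinate recovers the multiplier; absence of small torsion then recovers `b`.
  · simp only [Sum.elim_inl, Prod.smul_mk, Prod.mk.injEq, zsmul_one] at h
    obtain ⟨h1, h2⟩ := h
    obtain rfl := hR s t hs' ht' h1
    exact ⟨congrArg _ (sub_eq_zero.1 (hB s hs hs' _ (by rw [smul_sub, h2, sub_self]))), rfl⟩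
  · simp only [Sum.elim_inl, Sum.elim_inr, Prod.smul_mk, Prod.mk.injEq, zsmul_one, smul_zero] at h
    exact absurd (h0 s hs' h.1) hs
  · simp only [Sum.elim_inl, Sum.elim_inr, Prod.smul_mk, Prod.mk.injEq, zsmul_one, smul_zero] at h
    exact absurd (h0 t ht' h.1.symm) ht
  · simp only [Sum.elim_inr, Prod.smul_mk, Prod.mk.injEq] at h
    obtain ⟨h1, h2⟩ := hg i j s t hs hs' ht ht' h.2
    exact ⟨congrArg _ h1, h2⟩

/-- The labelling `|H| * X + e Y`, where `(X, Y) = ∑ i, x i • g i` and `e` enumerates `H`. -/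
theorem bigLambda_cartesianProduct_le_of_stepInjective {p k d : ℕ} (hp : 1 ≤ p) {H : Type*}
    [AddCommGroup H] [Finite H] (g : Fin d → ℤ × H) (hg : StepInjective k g)
    (h01 : ∀ i, (g i).1 = 0 ∨ (g i).1 = 1) (h1 : p = 1 ∨ ∀ i, (g i).1 = 1)
    (V : Fin d → Type u) [∀ i, Finite (V i)] (G : ∀ i, SimpleGraph (V i))
    (hG : ∀ i, bigLambda p (G i) ≤ k) :
    bigLambda p (cartesianProduct G) ≤ (k + 1) * Nat.card H := by
  set N := Nat.card H
  have e : H ≃ Fin N := Finite.equivFin H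
  have hN : 0 < N := Nat.card_pos
  let lin : ℤ × H → ℤ := fun q => N * q.1 + (e q.2 : ℕ)
  have hlin : ∀ q r : ℤ × H, ∃ δ : ℤ, lin q - lin r = N * (q.1 - r.1) + δ ∧ |δ| < N := by
    intro q r
    refine ⟨(e q.2 : ℕ) - (e r.2 : ℕ), by simp only [lin]; ring, ?_⟩
    have h1 := (e q.2).2
    have h2 := (e r.2).2
    rw [abs_lt]
    omega
  have linj : Function.Injective lin := by
    intro q r h
    obtain ⟨δ, h1, h2⟩ := hlin q r
    rw [h, sub_self] at h1
    have h3 : q.1 - r.1 = 0 := by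
      have hdvd : (N : ℤ) ∣ δ := ⟨-(q.1 - r.1), by linarith⟩
      have h4 := Int.eq_zero_of_abs_lt_dvd hdvd h2
      rw [h4, add_zero] at h1
      exact (mul_eq_zero.1 h1.symm).resolve_left (by omega)
    have h4 : q.1 = r.1 := by linarith
    refine Prod.ext h4 (e.injective (Fin.ext ?_))
    simp only [lin, h4] at h
    exact_mod_cast add_left_cancel h
  let Φ : (Fin d → ℤ) → ℤ × H := fun x => ∑ i, x i • g i
  have key : ∀ (x : Fin d → ℤ) i (s : ℤ), Φ (x + Pi.single i s) = Φ x + s • g i := by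
    intro x i s
    simp only [Φ, Pi.add_apply, add_smul, Finset.sum_add_distrib, Pi.single_apply, ite_smul,
      zero_smul, Finset.sum_ite_eq', Finset.mem_univ, if_true]
  have hpos : ∀ s : ℤ, p ≤ |s| → s ≠ 0 := by
    rintro s h rfl
    rw [abs_zero] at h
    omega
  refine bigLambda_cartesianProduct_le (fun x => lin (Φ x)) hp ?_ ?_ ?_ V G hG
  · intro x i s hs hs'
    rw [key]
    rcases h1 with rfl | h1
    · refine Int.one_le_abs (sub_ne_zero.2 fun h => ?_)
      exact hg.smul_ne_zero i (hpos s hs) hs' (by simpa using linj h)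
    · obtain ⟨δ, h2, h3⟩ := hlin (Φ x + s • g i) (Φ x)
      rw [h2]
      have h4 : (Φ x + s • g i).1 - (Φ x).1 = s := by simp [h1]
      -- `|N * s + δ| ≥ N * |s| - (N - 1) ≥ |s| ≥ p`.
      have h5 := abs_sub_abs_le_abs_sub ((N : ℤ) * s) (-δ)
      rw [h4]
      rw [sub_neg_eq_add, abs_neg, abs_mul, Nat.abs_cast] at h5
      nlinarith
  · intro x i s hs hs'
    rw [key]
    obtain ⟨δ, h2, h3⟩ := hlin (Φ x + s • g i) (Φ x)
    rw [h2]
    have h4 : |(Φ x + s • g i).1 - (Φ x).1| ≤ k := by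
      rcases h01 i with h | h <;> simp [h, hs']
    have h5 := abs_add_le ((N : ℤ) * ((Φ x + s • g i).1 - (Φ x).1)) δ
    rw [abs_mul, Nat.abs_cast] at h5
    push_cast
    nlinarith
  · intro x i j s t hs hs' ht ht' h
    simp only [key] at h
    exact hg i j s t (hpos s hs) hs' (hpos t ht) ht' (add_left_cancel (linj h))

theorem exists_coprime_factorial (k n : ℕ) :
    ∃ m, n ≤ m ∧ m ≤ n + k.factorial + 1 ∧ 0 < m ∧ m.Coprime k.factorial := by
  have hk := Nat.factorial_pos k
  have h1 := Nat.div_add_mod n k.factorial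
  have h2 := Nat.mod_lt n hk
  refine ⟨k.factorial * (n / k.factorial + 1) + 1, ?_, ?_, by omega, ?_⟩
  · rw [mul_add]
    omega
  · rw [mul_add]
    omega
  · simp

/-- The generators are `(1, b)` with `b` in `ZMod m`, where `m ≥ d` is coprime to `k!`, so that
`ZMod m` has no small torsion. -/
theorem bigLambda_cartesianProduct_le_of_le_add {p k d : ℕ} (hp : 1 ≤ p)
    (V : Fin d → Type u) [∀ i, Finite (V i)] (G : ∀ i, SimpleGraph (V i))
    (hG : ∀ i, bigLambda p (G i) ≤ k) :
    bigLambda p (cartesianProduct G) ≤ (k + 1) * (d + k.factorial + 1) := by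
  obtain ⟨m, hdm, hm, hpos, hcop⟩ := exists_coprime_factorial k d
  have : NeZero m := ⟨hpos.ne'⟩
  obtain ⟨f⟩ := Function.Embedding.nonempty_of_card_le (α := Fin d) (β := ZMod m)
    (by simpa [ZMod.card] using hdm)
  have hs : StepInjective k (fun i : Empty => (i.elim : ZMod m)) := fun i => i.elim
  have hg := (hs.sumElim (R := ℤ) (fun s t _ _ h => by simpa using h)
    (noSmallTorsion_zmod hcop)).comp (f := fun i => Sum.inl (f i))
    (Sum.inl_injective.comp f.injective)
  refine (bigLambda_cartesianProduct_le_of_stepInjective hp _ hg (fun i => Or.inr rfl)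
    (Or.inr fun i => rfl) V G hG).trans ?_
  rw [Nat.card_zmod]
  exact Nat.mul_le_mul_left _ hm

theorem intCast_zmod_five_inj (s t : ℤ) (hs : |s| ≤ (2 : ℕ)) (ht : |t| ≤ (2 : ℕ))
    (h : (s : ZMod 5) = t) : s = t := by
  have h1 := (ZMod.intCast_eq_intCast_iff s t 5).1 h
  rw [abs_le] at hs ht
  unfold Int.ModEq at h1
  push_cast at *
  omega

/-- For `k = 2` and `p = 1` the coordinates are indexed by a partial Hamming code. -/
theorem bigLambda_cartesianProduct_le_of_two {d : ℕ}
    (V : Fin d → Type u) [∀ i, Finite (V i)] (G : ∀ i, SimpleGraph (V i))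
    (hG : ∀ i, bigLambda 1 (G i) ≤ 2) :
    bigLambda 1 (cartesianProduct G) ≤ 75 * (d / 31 + 4) := by
  obtain ⟨m, hdm, hm, hpos, hcop⟩ := exists_coprime_factorial 2 (d / 31 + 1)
  have : NeZero m := ⟨hpos.ne'⟩
  have t5 : NoSmallTorsion 2 (ZMod 5) := noSmallTorsion_zmod (by decide)
  have tm : NoSmallTorsion 2 (ZMod m) := noSmallTorsion_zmod hcop
  have hs : StepInjective 2 (fun i : Empty => (i.elim : ZMod m)) := fun i => i.elim
  -- Here `H` has order `25 * m` and carries `25 * m + 5 * m + m = 31 * m` generators, whence the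
  -- ratio `3 * 25 / 31`.
  have hg := ((hs.sumElim intCast_zmod_five_inj tm).sumElim intCast_zmod_five_inj
    (t5.prod tm)).sumElim (R := ℤ) (fun s t _ _ h => by simpa using h) (t5.prod (t5.prod tm))
  obtain ⟨f⟩ := Function.Embedding.nonempty_of_card_le (α := Fin d)
    (β := (ZMod 5 × ZMod 5 × ZMod m) ⊕ (ZMod 5 × ZMod m) ⊕ ZMod m ⊕ Empty) (by
      simp only [Fintype.card_fin, Fintype.card_sum, Fintype.card_prod, ZMod.card,
        Fintype.card_empty]
      omega)
  refine (bigLambda_cartesianProduct_le_of_stepInjective le_rfl _ (hg.comp f.injective)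
    (fun i => ?_) (Or.inl rfl) V G hG).trans ?_
  · rcases h : f i with y | y
    · right
      simp [h]
    · left
      simp [h]
  · simp only [Nat.card_prod, Nat.card_zmod]
    have : Nat.factorial 2 = 2 := rfl
    omega

/-- For `p ≥ 2` and `k = 2` only steps of length `2` are allowed. -/
theorem bigLambda_cartesianProduct_le_two_mul {p d : ℕ} (hp : 2 ≤ p)
    (V : Fin d → Type u) [∀ i, Finite (V i)] (G : ∀ i, SimpleGraph (V i))
    (hG : ∀ i, bigLambda p (G i) ≤ 2) : bigLambda p (cartesianProduct G) ≤ 2 * d := by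
  refine bigLambda_cartesianProduct_le_linear (fun i => (i : ℕ) + 1) (by omega) (fun i => ?_)
    (fun i => ?_) ?_ V G hG
  · omega
  · have := i.2
    omega
  · intro i j s t h1 h2 h3 h4 h5
    have hs : |s| = 2 := le_antisymm h2 (by omega)
    have ht : |t| = 2 := le_antisymm h4 (by omega)
    have h6 := congrArg abs h5
    rw [abs_mul, abs_mul, hs, ht, abs_of_nonneg (by positivity), abs_of_nonneg (by positivity)]
      at h6
    exact Fin.ext (by omega)

/-! ### Numerical estimates and conclusion -/

theorem lt_eulerMascheroniConstant : 0.56 < Real.eulerMascheroniConstant := by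
  -- The index `31` makes the logarithm `log 32 = 5 * log 2`.
  refine lt_trans ?_ (Real.eulerMascheroniSeq_lt_eulerMascheroniConstant 31)
  have h : Real.log (((31 : ℕ) : ℝ) + 1) = 5 * Real.log 2 := by
    rw [show ((31 : ℕ) : ℝ) + 1 = 2 ^ (5 : ℕ) by norm_num, Real.log_pow]
    norm_num
  rw [Real.eulerMascheroniSeq, h]
  have h2 := Real.log_two_lt_d9
  have h3 : (4.027 : ℝ) < (harmonic 31 : ℚ) := by
    norm_num [harmonic, Finset.sum_range_succ]
  linarith

theorem lt_exp_eulerMascheroniConstant :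
    1.75 < Real.exp Real.eulerMascheroniConstant := by
  refine lt_of_lt_of_le ?_ (Real.exp_le_exp.2 lt_eulerMascheroniConstant.le)
  have h := Real.sum_le_exp_of_nonneg (x := 0.56) (by norm_num) 6
  refine lt_of_lt_of_le ?_ h
  norm_num [Finset.sum_range_succ, Nat.factorial]

theorem lt_log_three : 1.09 < Real.log 3 := by
  rw [Real.lt_log_iff_exp_lt (by norm_num)]
  have h : Real.exp 1.09 = Real.exp 1 * Real.exp 0.09 := by
    rw [← Real.exp_add]
    norm_num
  have h1 := Real.exp_one_lt_d9
  have h2 := Real.exp_bound' (x := 0.09) (by norm_num) (by norm_num) (n := 4) (by norm_num)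
  norm_num [Finset.sum_range_succ, Nat.factorial] at h2
  rw [h]
  norm_num
  nlinarith [Real.exp_pos 1, Real.exp_pos (9 / 100)]

theorem exists_forall_bigLambda_cartesianProduct_le (k : ℕ) (hk : 2 ≤ k) :
    ∃ d₀ : ℕ, ∀ d : ℕ, d₀ < d → ∀ p : ℕ, 1 ≤ p →
      ∀ (V : Fin d → Type u) [∀ i, Finite (V i)] (G : ∀ i, SimpleGraph (V i)),
        (∀ i, bigLambda p (G i) ≤ k) →
          (bigLambda p (cartesianProduct G) : ℝ) ≤
            Real.exp Real.eulerMascheroniConstant * (d * k * Real.log k) := by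
  have he := lt_exp_eulerMascheroniConstant
  obtain rfl | hk := hk.eq_or_lt
  · refine ⟨100000, fun d hd p hp V _ G hG => ?_⟩
    have hd' : (100000 : ℝ) < d := by exact_mod_cast hd
    have hl := Real.log_two_gt_d9
    -- The margin is thin: `75 / 31 < 2.4194`, against `2 * 1.2125 = 2.425`; a large `d` absorbs the
    -- additive `300`.
    have h1 : (1.2125 : ℝ) < Real.exp Real.eulerMascheroniConstant * Real.log 2 := by
      nlinarith
    have h2 : (bigLambda p (cartesianProduct G) : ℝ) ≤ 75 / 31 * d + 300 := by
      obtain rfl | hp := hp.eq_or_lt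
      · have h3 : (bigLambda 1 (cartesianProduct G) : ℝ) ≤ (75 * (d / 31 + 4) : ℕ) := by
          exact_mod_cast bigLambda_cartesianProduct_le_of_two V G hG
        have h4 : ((d / 31 : ℕ) : ℝ) ≤ (d : ℝ) / (31 : ℕ) := Nat.cast_div_le
        push_cast at h3 h4
        linarith
      · have h3 : (bigLambda p (cartesianProduct G) : ℝ) ≤ (2 * d : ℕ) := by
          exact_mod_cast bigLambda_cartesianProduct_le_two_mul hp V G hG
        push_cast at h3
        linarith
    push_cast
    nlinarith
  -- Beyond this threshold the additive error is below `d`, so the edge span is at most `(k + 2) *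
  -- d`.
  · refine ⟨(k + 1) * (k.factorial + 1), fun d hd p hp V _ G hG => ?_⟩
    have hd' : ((k : ℝ) + 1) * (k.factorial + 1) < d := by exact_mod_cast hd
    have hk' : (3 : ℝ) ≤ k := by exact_mod_cast hk
    have hl : 1.09 < Real.log k := lt_log_three.trans_le (Real.log_le_log (by norm_num) hk')
    have h1 : (bigLambda p (cartesianProduct G) : ℝ) ≤ (k + 1) * (d + k.factorial + 1) := by
      exact_mod_cast bigLambda_cartesianProduct_le_of_le_add hp V G hG
    have h2 : (1.9 : ℝ) < Real.exp Real.eulerMascheroniConstant * Real.log k := by nlinarith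
    have h3 : (k : ℝ) + 2 ≤ Real.exp Real.eulerMascheroniConstant * Real.log k * k := by nlinarith
    have h4 : (0 : ℝ) ≤ d := d.cast_nonneg
    calc (bigLambda p (cartesianProduct G) : ℝ) ≤ (k + 2) * d := by linarith
      _ ≤ Real.exp Real.eulerMascheroniConstant * Real.log k * k * d :=
        mul_le_mul_of_nonneg_right h3 h4
      _ = _ := by ring

theorem mainTheorem12 :
    -- `λ_{p,1}(G) ≤ k` implies `Λ_{p,1}(G) ≤ k`
    (∀ (p k : ℕ), 1 ≤ p → ∀ (V : Type u) [Finite V] (G : SimpleGraph V),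
      smallLambda p G ≤ k → bigLambda p G ≤ k) ∧
    -- the bounds for all `d`
    (∀ (p k d : ℕ), 1 ≤ p → 1 ≤ d →
      ∀ (V : Fin d → Type u) [∀ i, Finite (V i)] (G : ∀ i, SimpleGraph (V i)),
        (∀ i, bigLambda p (G i) ≤ k) →
          (bigLambda p (cartesianProduct G) : ℤ) ≤ k * (k * d - k + 1) ∧
          (smallLambda p (cartesianProduct G) : ℤ) ≤ 2 * k * (k * d - k + 1) + 1) ∧
    -- the improved bounds for large `d`
    (∀ (k : ℕ), 2 ≤ k → ∀ (ε : ℝ), 0 < ε → ε < 1 → ∃ d₀ : ℕ, ∀ (d : ℕ), d₀ < d →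
      ∀ (p : ℕ), 1 ≤ p →
      ∀ (V : Fin d → Type u) [∀ i, Finite (V i)] (G : ∀ i, SimpleGraph (V i)),
        (∀ i, bigLambda p (G i) ≤ k) →
          (bigLambda p (cartesianProduct G) : ℝ) ≤
            Real.exp Real.eulerMascheroniConstant / (1 - ε) * (d * k * Real.log k) ∧
          (smallLambda p (cartesianProduct G) : ℝ) ≤
            1 + 2 * Real.exp Real.eulerMascheroniConstant / (1 - ε) * (d * k * Real.log k)) := by
  have hsmall : ∀ (p : ℕ) {V : Type u} [Finite V] (G : SimpleGraph V) (B : ℝ),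
      (bigLambda p G : ℝ) ≤ B → (smallLambda p G : ℝ) ≤ 2 * B := by
    intro p V _ G B h
    have : (smallLambda p G : ℝ) ≤ 2 * bigLambda p G := by
      exact_mod_cast smallLambda_le_two_mul_bigLambda p G
    linarith
  refine ⟨fun p k _ V _ G h => (bigLambda_le_smallLambda p G).trans h, ?_, ?_⟩
  · intro p k d hp hd V _ G hG
    have h1 := bigLambda_cartesianProduct_le_sq hp hd V G hG
    have h2 : (bigLambda p (cartesianProduct G) : ℤ) ≤ k * (k * d - k + 1) := by
      have h3 : (bigLambda p (cartesianProduct G) : ℤ) ≤ ((k * (k * (d - 1) + 1) : ℕ) : ℤ) := by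
        exact_mod_cast h1
      push_cast [hd] at h3
      linarith
    have h4 : (smallLambda p (cartesianProduct G) : ℤ) ≤ 2 * bigLambda p (cartesianProduct G) := by
      exact_mod_cast smallLambda_le_two_mul_bigLambda p (cartesianProduct G)
    exact ⟨h2, by linarith⟩
  · intro k hk ε h0 h1
    obtain ⟨d₀, h⟩ := exists_forall_bigLambda_cartesianProduct_le.{u} k hk
    refine ⟨d₀, fun d hd p hp V _ G hG => ?_⟩
    have hlog : 0 ≤ (d : ℝ) * k * Real.log k := by positivity
    have h2 : (bigLambda p (cartesianProduct G) : ℝ) ≤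
        Real.exp Real.eulerMascheroniConstant / (1 - ε) * (d * k * Real.log k) := by
      refine (h d hd p hp V G hG).trans (mul_le_mul_of_nonneg_right ?_ hlog)
      exact le_div_self (Real.exp_pos _).le (by linarith) (by linarith)
    refine ⟨h2, (hsmall p _ _ h2).trans (le_of_lt ?_)⟩
    rw [mul_div_assoc, mul_assoc]
    linarith
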